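/- Let $(P_i)_{i\in\mathbb N}$ be an infinite sequence of $p$-values, i.e. $[0,1]$-valued random variables on a probability space (the distribution under a fixed parameter of the statistical model), such that each $P_i$ has an absolutely continuous distribution, with cdf $F_i$. Put $\tilde P_i = F_i(P_i)$ and assume that $(P_i)$ is $H_0$-exchangeable, meaning that $(\tilde P_i)_{i\in\mathbb N}$ is an exchangeable sequence. Let $Z$ be a real random variable such that, for every $m$ and all real $p_1,\dots,p_m$, $$F_{\tilde P_1,\dots,\tilde P_m}(p_1,\dots,p_m)=\int F_{\tilde P_1\mid Z=z}(p_1)\cdots F_{\tilde P_m\mid Z=z}(p_m)\,dF_Z(z)$$ (a de Finetti mixing variable), where $F_{\tilde P_i\mid Z=z}$ is the conditional cdf of $\tilde P_i$ given $Z=z$ and $F_Z$ is the cdf of $Z$. Let $\psi(t)=\mathbb E[\exp(-tZ)]$, $t\in[0,\infty)$, $\psi(\infty)=0$, and let $\psi^{-1}:[0,1]\to[0,\infty]$ be the inverse of $\psi$, so that $\psi^{-1}(0)=\infty$; put $\exp(-\infty)=0$. Assume that (i) $Z\in(0,\infty)$ with probability $1$; (ii) for every $i$ and for almost every $z\in(0,\infty)$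 with respect to the distribution of $Z$, $F_{\tilde P_i\mid Z=z}(p)=\exp(-z\,\psi^{-1}(p))$ for all $p\in[0,1]$. Then, for every $m$, the function $$C(p_1,\dots,p_m)=\psi\Big(\sum_{i=1}^m\psi^{-1}(p_i)\Big),\qquad (p_1,\dots,p_m)\in[0,1]^m,$$ is a copula of $(P_1,\dots,P_m)$; that is, $C$ is the restriction to $[0,1]^m$ of the joint cdf of a distribution with $\mathrm{UNI}[0,1]$ marginals, and for all $x\in\mathbb R^m$ $$\mathbb P(P_1\le x_1,\dots,P_m\le x_m)=C\big(F_1(x_1),\dots,F_m(x_m)\big).$$ -/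

import Mathlib

open MeasureTheory ProbabilityTheory
open scoped ENNReal

noncomputable section

namespace ExchPVal

variable {Ω : Type*} [MeasurableSpace Ω]

/-- A sequence of real random variables is exchangeable if, for every `n`, the law of
`(X 0, …, X (n - 1))` is invariant under all permutations of the coordinates. -/
def Exchangeable (X : ℕ → Ω → ℝ) (μ : Measure Ω) : Prop :=
  ∀ (n : ℕ) (σ : Equiv.Perm (Fin n)),
    μ.map (fun ω (i : Fin n) => X (σ i) ω) = μ.map (fun ω (i : Fin n) => X i ω)

/-- The transformed `p`-values `F_i(P_i)`, where `F_i` is the cdf of `P_i` under `μ`. -/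
def transformed (P : ℕ → Ω → ℝ) (μ : Measure Ω) (i : ℕ) (ω : Ω) : ℝ :=
  cdf (μ.map (P i)) (P i ω)

/-- `H₀`-exchangeability: the transformed `p`-values `F_i(P_i)` are exchangeable. -/
def H0Exchangeable (P : ℕ → Ω → ℝ) (μ : Measure Ω) : Prop :=
  Exchangeable (transformed P μ) μ

/-- The conditional cdf `F_{X | Z = z}(p)`, through the regular conditional distribution of `X`
given `Z`. -/
def condCdf (X Z : Ω → ℝ) (μ : Measure Ω) [IsFiniteMeasure μ] (z p : ℝ) : ℝ :=
  cdf (condDistrib X Z μ z) p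

/-- `Z` is a de Finetti mixing variable of the sequence `X`: all finite-dimensional joint cdfs of
`X` are mixtures, over the law of `Z`, of the products of the conditional cdfs given `Z = z`. -/
def IsMixingVariable (X : ℕ → Ω → ℝ) (Z : Ω → ℝ) (μ : Measure Ω) [IsFiniteMeasure μ] : Prop :=
  ∀ (m : ℕ) (p : Fin m → ℝ),
    μ.real {ω | ∀ i : Fin m, X i ω ≤ p i} = ∫ z, ∏ i : Fin m, condCdf (X i) Z μ z (p i) ∂(μ.map Z)

/-- The Laplace transform `ψ(t) = E[exp(-tZ)]` of `Z` on `[0, ∞]`, with `ψ(∞) = 0`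
(the limit at infinity when `Z > 0` almost surely). -/
def laplace (Z : Ω → ℝ) (μ : Measure Ω) (t : ℝ≥0∞) : ℝ :=
  if t = ∞ then 0 else ∫ ω, Real.exp (-(t.toReal * Z ω)) ∂μ

/-- The inverse `ψ⁻¹(p) ∈ [0, ∞]`. When `Z > 0` almost surely, `ψ : [0, ∞] → [0, 1]` is a strictly
decreasing bijection, so that for `p ∈ [0, 1]` the set below has exactly one element;
in particular `ψ⁻¹(0) = ∞`. -/
def laplaceInv (Z : Ω → ℝ) (μ : Measure Ω) (p : ℝ) : ℝ≥0∞ :=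
  sInf {t : ℝ≥0∞ | laplace Z μ t = p}

/-- `exp(-x)` for `x ∈ [0, ∞]`, with `exp(-∞) = 0`. -/
def expNeg (x : ℝ≥0∞) : ℝ :=
  if x = ∞ then 0 else Real.exp (-x.toReal)

/-- `C`, of which only the values on `[0, 1]^m` matter, is an `m`-dimensional copula: on `[0, 1]^m`
it is the joint cdf of a probability measure whose one-dimensional marginals are all
uniform on `[0, 1]`. -/
def IsCopula {m : ℕ} (C : (Fin m → ℝ) → ℝ) : Prop :=
  ∃ ν : Measure (Fin m → ℝ), IsProbabilityMeasure ν ∧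
    (∀ i, ν.map (fun u => u i) = volume.restrict (Set.Icc (0 : ℝ) 1)) ∧
    ∀ u : Fin m → ℝ, (∀ i, u i ∈ Set.Icc (0 : ℝ) 1) → C u = ν.real {v | ∀ i, v i ≤ u i}

/-- `C` is a copula of the random vector `(Y_1, …, Y_m)`: `C` is a copula and
`F_Y(x) = C(F_{Y_1}(x_1), …, F_{Y_m}(x_m))` for all `x`. -/
def IsCopulaOf {m : ℕ} (C : (Fin m → ℝ) → ℝ) (Y : Fin m → Ω → ℝ) (μ : Measure Ω) : Prop :=
  IsCopula C ∧
    ∀ x : Fin m → ℝ, μ.real {ω | ∀ i, Y i ω ≤ x i} = C (fun i => cdf (μ.map (Y i)) (x i))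

end ExchPVal

end

namespace ExchPVal

open Set Filter Topology

/-! Given `Z = z`, the joint cdf of the `F_i(P_i)` is a product of exponentials `exp(-z ψ⁻¹(u_i))`,
hence the exponential of a sum; averaging over `Z` gives `ψ` of that sum
(`measureReal_le_eq_laplace`). So the law of this vector witnesses that `C` is a copula: its
marginals are uniform because absolute continuity excludes atoms (`map_cdf`). Flat stretches of
`F_i` carry no mass, so `ae_le_iff_cdf_le` transfers the formula back to the `P_i`. Only the form of
the conditional cdfs is used of `ψ⁻¹`, never that it inverts `ψ`. -/

/-- The cdf of an atomless probability measure is continuous. -/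
lemma continuous_cdf (ρ : Measure ℝ) [IsProbabilityMeasure ρ] [NullSingletonClass ρ] :
    Continuous (cdf ρ) := by
  rw [continuous_iff_continuousAt]
  intro x
  rw [(monotone_cdf ρ).continuousAt_iff_leftLim_eq_rightLim, StieltjesFunction.rightLim_eq]
  have h : (cdf ρ).measure {x} = 0 := by rw [measure_cdf]; exact measure_singleton x
  rw [StieltjesFunction.measure_singleton, ENNReal.ofReal_eq_zero] at h
  exact le_antisymm ((monotone_cdf ρ).leftLim_le le_rfl) (by linarith)

/-- By continuity the sublevel set is a closed half-line, nonempty since `0 < u` and bounded above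
since `u < 1`; the cdf equals `u` at its right end. -/
lemma measureReal_cdf_le_of_mem_Ioo (ρ : Measure ℝ) [IsProbabilityMeasure ρ] [NullSingletonClass ρ] {u : ℝ}
    (hu : u ∈ Ioo (0 : ℝ) 1) : ρ.real {y | cdf ρ y ≤ u} = u := by
  have hc := continuous_cdf ρ
  obtain ⟨a, ha⟩ := ((tendsto_cdf_atBot ρ).eventually_lt_const hu.1).exists
  obtain ⟨b, hb⟩ := ((tendsto_cdf_atTop ρ).eventually_const_lt hu.2).exists
  obtain ⟨x, hx⟩ := mem_range_of_exists_le_of_exists_ge hc ⟨a, ha.le⟩ ⟨b, hb.le⟩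
  have hbdd : BddAbove {y | cdf ρ y ≤ u} :=
    ⟨b, fun y hy => le_of_not_gt fun h => (hb.trans_le (monotone_cdf ρ h.le)).not_ge hy⟩
  have hs : cdf ρ (sSup {y | cdf ρ y ≤ u}) ≤ u :=
    (isClosed_le hc continuous_const).csSup_mem ⟨a, ha.le⟩ hbdd
  have hset : {y | cdf ρ y ≤ u} = Iic (sSup {y | cdf ρ y ≤ u}) :=
    Subset.antisymm (fun y hy => le_csSup hbdd hy)
      fun y hy => (monotone_cdf ρ hy).trans hs
  rw [hset, ← cdf_eq_real]
  refine le_antisymm hs ?_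
  conv_lhs => rw [← hx]
  exact monotone_cdf ρ (le_csSup hbdd hx.le)

lemma measureReal_cdf_le (ρ : Measure ℝ) [IsProbabilityMeasure ρ] [NullSingletonClass ρ] {u : ℝ}
    (hu : u ∈ Icc (0 : ℝ) 1) : ρ.real {y | cdf ρ y ≤ u} = u := by
  rcases hu.1.eq_or_lt with rfl | h0
  -- At `u = 0` the sublevel set may be empty, so its mass is squeezed by small positive levels.
  · refine le_antisymm (le_of_forall_pos_le_add fun ε hε => ?_) measureReal_nonneg
    have hmem : min ε (1 / 2) ∈ Ioo (0 : ℝ) 1 :=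
      ⟨by positivity, (min_le_right _ _).trans_lt (by norm_num)⟩
    calc ρ.real {y | cdf ρ y ≤ 0} ≤ ρ.real {y | cdf ρ y ≤ min ε (1 / 2)} :=
          measureReal_mono fun y (hy : _ ≤ _) => hy.trans hmem.1.le
      _ = min ε (1 / 2) := measureReal_cdf_le_of_mem_Ioo ρ hmem
      _ ≤ 0 + ε := by simp
  rcases hu.2.eq_or_lt with rfl | h1
  · simp [cdf_le_one]
  · exact measureReal_cdf_le_of_mem_Ioo ρ ⟨h0, h1⟩

/-- The probability integral transform: an atomless law is mapped by its own cdf to the uniform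
distribution. -/
lemma map_cdf (ρ : Measure ℝ) [IsProbabilityMeasure ρ] [NullSingletonClass ρ] :
    ρ.map (cdf ρ) = volume.restrict (Icc (0 : ℝ) 1) := by
  have hm : Measurable (cdf ρ) := (monotone_cdf ρ).measurable
  have : IsProbabilityMeasure (ρ.map (cdf ρ)) := Measure.isProbabilityMeasure_map hm.aemeasurable
  refine Measure.ext_of_Iic _ _ fun u => ?_
  rw [Measure.map_apply hm measurableSet_Iic, Measure.restrict_apply measurableSet_Iic]
  change ρ {y | cdf ρ y ≤ u} = _
  rcases lt_or_ge u 0 with h0 | h0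
  · have h1 : {y | cdf ρ y ≤ u} = ∅ :=
      eq_empty_of_forall_notMem fun y (hy : cdf ρ y ≤ u) => by linarith [cdf_nonneg ρ y]
    have h2 : Iic u ∩ Icc 0 1 = ∅ :=
      eq_empty_of_forall_notMem fun y hy => by linarith [hy.1.out, hy.2.1]
    simp [h1, h2]
  rcases le_or_gt u 1 with h1 | h1
  · have h2 : Iic u ∩ Icc 0 1 = Icc 0 u := by
      ext y
      exact ⟨fun h => ⟨h.2.1, h.1⟩, fun h => ⟨h.2, h.1, h.2.trans h1⟩⟩
    rw [h2, Real.volume_Icc, sub_zero, ← ofReal_measureReal, measureReal_cdf_le ρ ⟨h0, h1⟩]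
  · have h2 : Iic u ∩ Icc 0 1 = Icc 0 1 :=
      inter_eq_right.2 fun y hy => hy.2.trans h1.le
    have h3 : {y | cdf ρ y ≤ u} = univ :=
      eq_univ_of_forall fun y => (cdf_le_one ρ y).trans h1.le
    simp [h2, h3]

/-- Up to a null set, `y ≤ x` and `F y ≤ F x` are the same event when `F` is the cdf of an atomless
law. -/
lemma ae_le_iff_cdf_le (ρ : Measure ℝ) [IsProbabilityMeasure ρ] [NullSingletonClass ρ] (x : ℝ) :
    ∀ᵐ y ∂ρ, y ≤ x ↔ cdf ρ y ≤ cdf ρ x := by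
  have h : Iic x =ᵐ[ρ] {y | cdf ρ y ≤ cdf ρ x} := by
    refine ae_eq_of_subset_of_measure_ge (fun y hy => monotone_cdf ρ hy) ?_
      measurableSet_Iic.nullMeasurableSet (measure_ne_top _ _)
    -- The nested events both have mass `F x`.
    rw [← ofReal_cdf, ← ofReal_measureReal,
      measureReal_cdf_le ρ ⟨cdf_nonneg ρ x, cdf_le_one ρ x⟩]
  exact eventuallyEq_set.1 h

lemma expNeg_mul_of_ne_top {z : ℝ} (hz : 0 < z) {s : ℝ≥0∞} (hs : s ≠ ∞) :
    expNeg (ENNReal.ofReal z * s) = Real.exp (-(s.toReal * z)) := by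
  rw [expNeg, if_neg (ENNReal.mul_ne_top ENNReal.ofReal_ne_top hs), ENNReal.toReal_mul,
    ENNReal.toReal_ofReal hz.le, mul_comm]

/-- An infinite term makes both sides vanish, by the convention `exp(-∞) = 0`. -/
lemma prod_expNeg {ι : Type*} (s : Finset ι) (x : ι → ℝ≥0∞) :
    ∏ i ∈ s, expNeg (x i) = expNeg (∑ i ∈ s, x i) := by
  by_cases h : ∃ i ∈ s, x i = ∞
  · obtain ⟨i, hi, hx⟩ := h
    rw [Finset.prod_eq_zero hi (by simp [expNeg, hx]), expNeg,
      if_pos (ENNReal.sum_eq_top.2 ⟨i, hi, hx⟩)]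
  · push Not at h
    rw [expNeg, if_neg (ENNReal.sum_ne_top.2 h), ENNReal.toReal_sum h, ← Finset.sum_neg_distrib,
      Real.exp_sum]
    exact Finset.prod_congr rfl fun i hi => if_neg (h i hi)

variable {Ω : Type*} [MeasurableSpace Ω]

/-- The mixture over the law of `Z` of the functions `exp(-z s)` is the Laplace transform at `s`. -/
lemma integral_expNeg_mul (μ : Measure Ω) {Z : Ω → ℝ} (hZm : Measurable Z)
    (hZpos : ∀ᵐ ω ∂μ, 0 < Z ω) (s : ℝ≥0∞) :
    ∫ z, expNeg (ENNReal.ofReal z * s) ∂(μ.map Z) = laplace Z μ s := by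
  have hpos : ∀ᵐ z ∂(μ.map Z), 0 < z :=
    (ae_map_iff hZm.aemeasurable measurableSet_Ioi).2 hZpos
  by_cases hs : s = ∞
  · rw [laplace, if_pos hs]
    refine integral_eq_zero_of_ae ?_
    filter_upwards [hpos] with z hz
    -- Positivity of `z` is essential here: `0 * ∞ = 0` would give the value `1`.
    rw [hs, ENNReal.mul_top (ENNReal.ofReal_pos.2 hz).ne', expNeg, if_pos rfl, Pi.zero_apply]
  · rw [laplace, if_neg hs, integral_congr_ae (g := fun z => Real.exp (-(s.toReal * z)))]
    · exact integral_map hZm.aemeasurable (by fun_prop)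
    · filter_upwards [hpos] with z hz
      exact expNeg_mul_of_ne_top hz hs

/-- If the conditional cdfs given the mixing variable are `exp(-z ψ⁻¹(p))`, the joint cdf on the
unit cube is `ψ(∑ ψ⁻¹(u_i))`. -/
lemma measureReal_le_eq_laplace (μ : Measure Ω) [IsFiniteMeasure μ] {X : ℕ → Ω → ℝ} {Z : Ω → ℝ}
    (hZm : Measurable Z) (hZmix : IsMixingVariable X Z μ) (hZpos : ∀ᵐ ω ∂μ, 0 < Z ω)
    (hcond : ∀ i, ∀ᵐ z ∂(μ.map Z), ∀ p ∈ Icc (0 : ℝ) 1,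
      condCdf (X i) Z μ z p = expNeg (ENNReal.ofReal z * laplaceInv Z μ p))
    {m : ℕ} {u : Fin m → ℝ} (hu : ∀ i, u i ∈ Icc (0 : ℝ) 1) :
    μ.real {ω | ∀ i : Fin m, X i ω ≤ u i} = laplace Z μ (∑ i, laplaceInv Z μ (u i)) := by
  rw [hZmix m u, ← integral_expNeg_mul μ hZm hZpos]
  refine integral_congr_ae ?_
  filter_upwards [ae_all_iff.2 hcond] with z hz
  rw [Finset.mul_sum, ← prod_expNeg]
  exact Finset.prod_congr rfl fun i _ => hz i (u i) (hu i)

end ExchPVal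

theorem mainTheorem4 {Ω : Type*} [MeasurableSpace Ω] (μ : Measure Ω) [IsProbabilityMeasure μ]
    (P : ℕ → Ω → ℝ) (hPm : ∀ i, Measurable (P i))
    (hP01 : ∀ i, ∀ᵐ ω ∂μ, P i ω ∈ Set.Icc (0 : ℝ) 1)
    (hPac : ∀ i, μ.map (P i) ≪ volume)
    (hPex : ExchPVal.H0Exchangeable P μ)
    (Z : Ω → ℝ) (hZm : Measurable Z)
    (hZmix : ExchPVal.IsMixingVariable (ExchPVal.transformed P μ) Z μ)
    (hZpos : ∀ᵐ ω ∂μ, 0 < Z ω)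
    (hcond : ∀ i, ∀ᵐ z ∂(μ.map Z), ∀ p ∈ Set.Icc (0 : ℝ) 1,
      ExchPVal.condCdf (ExchPVal.transformed P μ i) Z μ z p =
        ExchPVal.expNeg (ENNReal.ofReal z * ExchPVal.laplaceInv Z μ p))
    (m : ℕ) :
    ExchPVal.IsCopulaOf
      (fun p : Fin m → ℝ => ExchPVal.laplace Z μ (∑ i, ExchPVal.laplaceInv Z μ (p i)))
      (fun i => P i) μ := by
  have hprob (i : ℕ) : IsProbabilityMeasure (μ.map (P i)) :=
    Measure.isProbabilityMeasure_map (hPm i).aemeasurable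
  have hatom (i : ℕ) : NullSingletonClass (μ.map (P i)) := ⟨fun x => hPac i (measure_singleton x)⟩
  have hFm (i : ℕ) : Measurable (cdf (μ.map (P i))) := (monotone_cdf _).measurable
  have hTm (i : ℕ) : Measurable (ExchPVal.transformed P μ i) := (hFm i).comp (hPm i)
  have hVm : Measurable fun ω (i : Fin m) => ExchPVal.transformed P μ i ω :=
    measurable_pi_lambda _ fun i => hTm i
  refine ⟨⟨μ.map fun ω (i : Fin m) => ExchPVal.transformed P μ i ω,
    Measure.isProbabilityMeasure_map hVm.aemeasurable, fun i => ?_, fun u hu => ?_⟩, fun x => ?_⟩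
  · rw [Measure.map_map (measurable_pi_apply i) hVm, ← ExchPVal.map_cdf (μ.map (P i)),
      Measure.map_map (hFm i) (hPm i)]
    rfl
  · exact (ExchPVal.measureReal_le_eq_laplace μ hZm hZmix hZpos hcond hu).symm.trans
      (map_measureReal_apply hVm (measurableSet_Iic (a := u))).symm
  · refine Eq.trans ?_ (ExchPVal.measureReal_le_eq_laplace μ hZm hZmix hZpos hcond
      fun i => ⟨cdf_nonneg _ _, cdf_le_one _ _⟩)
    refine measureReal_congr (Filter.eventuallyEq_set.2 ?_)
    filter_upwards [ae_all_iff.2 fun i : Fin m =>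
      ae_of_ae_map (hPm i).aemeasurable (ExchPVal.ae_le_iff_cdf_le (μ.map (P i)) (x i))] with ω hω
    exact forall_congr' hω
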